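/- Let $(R,\mathfrak m,k)$ be a commutative Noetherian local ring of prime characteristic $p$ and of Krull dimension $d$, with $\operatorname{depth} R\ge 1$. Let $M$ be a finitely generated Cohen--Macaulay $R$-module (that is, $M\neq 0$ and $\operatorname{depth}_R M=\dim_R M$) such that $\operatorname{Supp}_R(M)=\operatorname{Spec}(R)$. For $e\ge 0$ let ${}^{e}M$ denote the abelian group $M$ with the $R$-module structure $r\cdot x=r^{p^e}x$. Then there is an integer $e_0\ge 0$, depending only on $R$ and $M$, such that for every integer $e\ge e_0$, every integer $t\ge 1$ and every finitely generated $R$-module $N$ the following holds: if $\operatorname{Ext}^i_R(N,{}^{e}M)=0$ for all $i=t,\dots,t+d-1$, then $$\operatorname{pd}_R(N)\le \min\{t-1,\ \operatorname{depth} R\}.$$ (The zero module has projective dimension $-\infty$.) -/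

import Mathlib

open CategoryTheory

universe u

/-- The depth of a module `M` over a local ring: the supremum of the lengths of the `M`-regular
sequences consisting of elements of the maximal ideal. -/
noncomputable def moduleDepth (R : Type*) [CommRing R] [IsLocalRing R]
    (M : Type*) [AddCommGroup M] [Module R M] : ℕ∞ :=
  ⨆ rs ∈ {rs : List R | (∀ r ∈ rs, r ∈ IsLocalRing.maximalIdeal R) ∧
    RingTheory.Sequence.IsRegular M rs}, (rs.length : ℕ∞)

/-- A finitely generated module over a local ring is Cohen-Macaulay if its depth equals its Krull
dimension. The zero module, of dimension `⊥`, does not satisfy this. -/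
def IsCohenMacaulayModule (R : Type*) [CommRing R] [IsLocalRing R]
    (M : Type*) [AddCommGroup M] [Module R M] : Prop :=
  Module.Finite R M ∧ (moduleDepth R M : WithBot ℕ∞) = Module.supportDim R M

/-- The `R`-module obtained from `M` by restriction of scalars along the `e`-th iterate
`r ↦ r ^ p ^ e` of the Frobenius endomorphism of `R`. -/
noncomputable def frobeniusTwist (R : Type u) [CommRing R] (p : ℕ) [Fact p.Prime] [CharP R p]
    (e : ℕ) (M : Type u) [AddCommGroup M] [Module R M] : ModuleCat.{u} R :=
  (ModuleCat.restrictScalars (iterateFrobenius R p e)).obj (ModuleCat.of R M)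

theorem frobeniusTwist_smul (R : Type u) [CommRing R] (p : ℕ) [Fact p.Prime] [CharP R p]
    (e : ℕ) (M : Type u) [AddCommGroup M] [Module R M] (r : R) (x : M) :
    (r • (show frobeniusTwist R p e M from x) : frobeniusTwist R p e M) =
      (show frobeniusTwist R p e M from (r ^ p ^ e) • x) := rfl

/-! Passing to syzygies reduces the claim to `t = 1`, where `N` must be free. Let `W ⊆ 𝔪F` be the
kernel of a minimal free cover `F → N`, and `xs` an `M`-regular sequence of length `d`. Since
`Ext¹(N, ᵉM) = 0`, every map `W → ᵉM` extends to `F`, so its values lie in `𝔪^(p^e) M`, hence in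
`(xs)M` for large `e`. Vanishing of `Extⁱ(W, ᵉM)` for `0 < i < d` upgrades this to `Hom(W, ᵉM) =
(xs) Hom(W, ᵉM)` (`mem_ofList_smul_top_of_forall_apply_mem`), and Nakayama gives `Hom(W, ᵉM) = 0`.
Now `Extⁱ(W, ᵉM) = 0` for all `i < d`, so `ann W` contains an `M`-regular sequence of length `d =
dim M` (`exists_isWeaklyRegular_annihilator`). As `M` has full support, `ann W` contains a power of
`𝔪`, hence a nonzerodivisor of `R`; since `W ⊆ F`, `W = 0`. The bound by `depth R` is half of
Auslander-Buchsbaum. -/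

/-! ### Minimal covers, depth and maximal regular sequences -/

open IsLocalRing RingTheory.Sequence in
theorem exists_pi_surjective_ker_le_maximalIdeal (R : Type u) [CommRing R] [IsLocalRing R]
    (N : Type u) [AddCommGroup N] [Module R N] [Module.Finite R N] :
    ∃ (n : ℕ) (g : (Fin n → R) →ₗ[R] N), Function.Surjective g ∧
      ∀ x ∈ LinearMap.ker g, ∀ i, x i ∈ maximalIdeal R := by
  -- Lifts of a basis of `k ⊗ N` generate `N` by Nakayama; independence of that basis puts the
  -- relations in `𝔪`.
  let b := Module.finBasis (ResidueField R) (TensorProduct R (ResidueField R) N)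
  choose f hf using fun i => TensorProduct.mk_surjective R N (ResidueField R)
    Ideal.Quotient.mk_surjective (b i)
  refine ⟨_, Fintype.linearCombination R f, ?_, fun x hx i => ?_⟩
  · rw [← LinearMap.range_eq_top, Fintype.range_linearCombination]
    exact IsLocalRing.span_eq_top_of_tmul_eq_basis f b hf
  · have h1 : ∑ j, residue R (x j) • b j = 0 := by
      have h2 := congrArg (TensorProduct.mk R (ResidueField R) N 1) (LinearMap.mem_ker.mp hx)
      rw [Fintype.linearCombination_apply, map_sum, map_zero] at h2
      rw [← h2]
      refine Finset.sum_congr rfl fun j _ => ?_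
      rw [map_smul, hf]
      exact algebraMap_smul (ResidueField R) (x j) (b j)
    have h3 := Fintype.linearIndependent_iff.mp b.linearIndependent _ h1 i
    exact (residue_eq_zero_iff _).mp h3

-- Cutting by `xs` brings the dimension to `0`. Full support makes the support of the quotient
-- `V(xs)`, which is thus the closed point.
open IsLocalRing RingTheory.Sequence in
theorem exists_maximalIdeal_pow_le_ofList {R : Type u} [CommRing R] [IsNoetherianRing R]
    [IsLocalRing R] {M : Type u} [AddCommGroup M] [Module R M] [Module.Finite R M]
    (hsupp : Module.support R M = Set.univ) {xs : List R} (hreg : IsRegular M xs)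
    (hlen : Module.supportDim R M = xs.length) :
    ∃ n : ℕ, maximalIdeal R ^ n ≤ Ideal.ofList xs := by
  have h0 : Module.supportDim R (M ⧸ Ideal.ofList xs • (⊤ : Submodule R M)) = 0 := by
    have h := Module.supportDim_add_length_eq_supportDim_of_isRegular xs hreg
    rw [hlen] at h
    have hnt := hreg.quot_ofList_smul_nontrivial ⊤
    have hb := (Module.supportDim_ne_bot_iff_nontrivial R
      (M ⧸ Ideal.ofList xs • (⊤ : Submodule R M))).mpr hnt
    generalize Module.supportDim R (M ⧸ Ideal.ofList xs • (⊤ : Submodule R M)) = a at h hb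
    induction a with
    | bot => exact absurd rfl hb
    | coe a =>
      induction a with
      | top =>
        have : (⊤ : ℕ∞) + (xs.length : ℕ∞) = (xs.length : ℕ∞) := by exact_mod_cast h
        simp at this
      | coe a =>
        have : a + xs.length = xs.length := by exact_mod_cast h
        have : a = 0 := by omega
        subst this
        rfl
  have h1 := support_of_supportDim_eq_zero R _ h0
  rw [Module.support_quotient, hsupp, Set.univ_inter] at h1
  have h2 := (PrimeSpectrum.zeroLocus_eq_iff.mp h1)
  have h3 : maximalIdeal R ≤ (Ideal.ofList xs).radical := h2 ▸ Ideal.le_radical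
  exact Ideal.exists_pow_le_of_le_radical_of_fg h3 (IsNoetherian.noetherian _)

-- For `n = 0` this would fail at `M = 0`, which has depth `0` as an empty supremum but no regular
-- sequence.
open IsLocalRing RingTheory.Sequence in
theorem exists_isRegular_length_eq_of_le_moduleDepth {R : Type*} [CommRing R] [IsLocalRing R]
    {M : Type*} [AddCommGroup M] [Module R M] {n : ℕ} (hn : 1 ≤ n) (h : n ≤ moduleDepth R M) :
    ∃ xs : List R, (∀ r ∈ xs, r ∈ maximalIdeal R) ∧ IsRegular M xs ∧ n ≤ xs.length := by
  by_contra! hcon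
  have : moduleDepth R M ≤ ((n - 1 : ℕ) : ℕ∞) := by
    refine iSup₂_le fun rs hrs => ?_
    have := hcon rs hrs.1 hrs.2
    exact_mod_cast (by omega : rs.length ≤ n - 1)
  have h2 : (n : ℕ∞) ≤ ((n - 1 : ℕ) : ℕ∞) := h.trans this
  have h3 : n ≤ n - 1 := by exact_mod_cast h2
  omega

open IsLocalRing RingTheory.Sequence in
theorem length_le_moduleDepth {R : Type*} [CommRing R] [IsLocalRing R]
    {M : Type*} [AddCommGroup M] [Module R M] {xs : List R} (hxs : ∀ r ∈ xs, r ∈ maximalIdeal R)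
    (hreg : IsRegular M xs) : (xs.length : ℕ∞) ≤ moduleDepth R M :=
  le_iSup₂_of_le (f := fun (rs : List R) (_ : rs ∈ {rs : List R |
    (∀ r ∈ rs, r ∈ maximalIdeal R) ∧ IsRegular M rs}) => (rs.length : ℕ∞)) xs ⟨hxs, hreg⟩ le_rfl

open IsLocalRing RingTheory.Sequence in
theorem exists_isRegular_length_eq_supportDim {R : Type*} [CommRing R] [IsNoetherianRing R]
    [IsLocalRing R] {M : Type*} [AddCommGroup M] [Module R M] (hM : IsCohenMacaulayModule R M)
    {d : ℕ} (hd : Module.supportDim R M = d) :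
    ∃ xs : List R, (∀ r ∈ xs, r ∈ maximalIdeal R) ∧ IsRegular M xs ∧ xs.length = d := by
  have := hM.1
  have hdep : moduleDepth R M = d := by
    have h := hM.2
    rw [hd] at h
    exact_mod_cast h
  have hnt : Nontrivial M := by
    rw [← Module.supportDim_ne_bot_iff_nontrivial R, hd]
    exact WithBot.coe_ne_bot
  obtain rfl | hpos := Nat.eq_zero_or_pos d
  · exact ⟨[], by simp, IsRegular.nil R M, rfl⟩
  · obtain ⟨xs, hxs, hreg, hle⟩ := exists_isRegular_length_eq_of_le_moduleDepth hpos hdep.ge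
    refine ⟨xs, hxs, hreg, le_antisymm ?_ hle⟩
    have h := length_le_moduleDepth hxs hreg
    rw [hdep] at h
    exact_mod_cast h

/-! ### Long exact Ext sequences for Frobenius twists -/

section Twist
open Pointwise
variable {R : Type u} [CommRing R] {p : ℕ} [Fact p.Prime] [CharP R p] {e : ℕ}
  {M : Type u} [AddCommGroup M] [Module R M] {W : Type u} [AddCommGroup W] [Module R W]

/-- Semilinear maps along the iterated Frobenius, as morphisms to the Frobenius twist. -/
noncomputable def frobeniusTwistOfHom (f : W →ₛₗ[iterateFrobenius R p e] M) :
    ModuleCat.of R W ⟶ frobeniusTwist R p e M :=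
  ModuleCat.ofHom (Y := frobeniusTwist R p e M)
    { toFun := fun w => (show frobeniusTwist R p e M from f w)
      map_add' := fun a b => f.map_add a b
      map_smul' := fun r w => f.map_smulₛₗ r w }

/-- Morphisms to the Frobenius twist, as semilinear maps along the iterated Frobenius. -/
noncomputable def frobeniusTwistHom (f : ModuleCat.of R W ⟶ frobeniusTwist R p e M) :
    W →ₛₗ[iterateFrobenius R p e] M where
  toFun := fun w => (show M from f.hom w)
  map_add' := fun a b => f.hom.map_add a b
  map_smul' := fun r w => f.hom.map_smul r w

variable (p e M) in
/-- The Frobenius twist of `M ⟶ M ⟶ M ⧸ xM`. -/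
noncomputable def frobeniusTwistSmulShortComplex (x : R) : ShortComplex (ModuleCat.{u} R) :=
  ((ModuleCat.of R M).smulShortComplex x).map (ModuleCat.restrictScalars (iterateFrobenius R p e))

theorem frobeniusTwistSmulShortComplex_shortExact {x : R} (hx : IsSMulRegular M x) :
    (frobeniusTwistSmulShortComplex p e M x).ShortExact :=
  ShortComplex.ShortExact.map_of_exact
    (S := (ModuleCat.of R M).smulShortComplex x) (IsSMulRegular.smulShortComplex_shortExact hx)
    (ModuleCat.restrictScalars (iterateFrobenius R p e))

theorem subsingleton_ext_frobeniusTwist_quotSMulTop {x : R} (hx : IsSMulRegular M x) {i : ℕ}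
    (h₀ : Subsingleton (Abelian.Ext (ModuleCat.of R W) (frobeniusTwist R p e M) i))
    (h₁ : Subsingleton (Abelian.Ext (ModuleCat.of R W) (frobeniusTwist R p e M) (i + 1))) :
    Subsingleton (Abelian.Ext (ModuleCat.of R W)
      (frobeniusTwist R p e (QuotSMulTop x M)) i) := by
  refine subsingleton_of_forall_eq 0 fun y => ?_
  obtain ⟨z, rfl⟩ := Abelian.Ext.covariant_sequence_exact₃ (ModuleCat.of R W)
    (frobeniusTwistSmulShortComplex_shortExact (p := p) (e := e) hx) y rfl (h₁.elim _ _)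
  have hz : z = 0 := h₀.elim z 0
  rw [hz, Abelian.Ext.zero_comp]
  rfl

/-- The obstruction to lifting along `ᵉM → ᵉ(M/xM)` lies in `Ext¹(W, ᵉM)`. -/
theorem exists_lift_frobeniusTwist_quotSMulTop {x : R} (hx : IsSMulRegular M x)
    (h : Subsingleton (Abelian.Ext (ModuleCat.of R W) (frobeniusTwist R p e M) 1))
    (f : W →ₛₗ[iterateFrobenius R p e] (QuotSMulTop x M)) :
    ∃ g : W →ₛₗ[iterateFrobenius R p e] M,
      (Submodule.mkQ (x • (⊤ : Submodule R M))).comp g = f := by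
  obtain ⟨z, hz⟩ := Abelian.Ext.covariant_sequence_exact₃ (ModuleCat.of R W)
    (frobeniusTwistSmulShortComplex_shortExact (p := p) (e := e) hx)
    (Abelian.Ext.mk₀ (frobeniusTwistOfHom f)) (zero_add 1) (h.elim _ _)
  obtain ⟨g, rfl⟩ := (Abelian.Ext.mk₀_bijective _ _).2 z
  rw [Abelian.Ext.mk₀_comp_mk₀] at hz
  have hz' := (Abelian.Ext.mk₀_bijective _ _).1 hz
  refine ⟨frobeniusTwistHom g, LinearMap.ext fun w => ?_⟩
  exact congrArg (fun k => k.hom w) hz'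

theorem subsingleton_ext_ker {F N : Type u} [AddCommGroup F] [Module R F] [AddCommGroup N]
    [Module R N] [Module.Projective R F] {g : F →ₗ[R] N} (hg : Function.Surjective g)
    (X : ModuleCat.{u} R) {i : ℕ}
    (h : Subsingleton (Abelian.Ext (ModuleCat.of R N) X (i + 2))) :
    Subsingleton (Abelian.Ext (ModuleCat.of R (LinearMap.ker g)) X (i + 1)) := by
  have hP : Projective (ModuleCat.of R F) := (IsProjective.iff_projective F).mp inferInstance
  refine subsingleton_of_forall_eq 0 fun y => ?_
  obtain ⟨z, rfl⟩ := Abelian.Ext.contravariant_sequence_exact₁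
    (LinearMap.shortExact_shortComplexKer hg) X y (show 1 + (i + 1) = i + 2 by omega)
    (h.elim _ _)
  rw [Abelian.Ext.eq_zero_of_projective (P := ModuleCat.of R F) z, Abelian.Ext.comp_zero]

theorem exists_extend_ker_frobeniusTwist {F N : Type u} [AddCommGroup F] [Module R F]
    [AddCommGroup N] [Module R N] {g : F →ₗ[R] N} (hg : Function.Surjective g)
    (h : Subsingleton (Abelian.Ext (ModuleCat.of R N) (frobeniusTwist R p e M) 1))
    (f : LinearMap.ker g →ₛₗ[iterateFrobenius R p e] M) :
    ∃ k : F →ₛₗ[iterateFrobenius R p e] M, ∀ w : LinearMap.ker g, k w = f w := by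
  obtain ⟨z, hz⟩ := Abelian.Ext.contravariant_sequence_exact₁
    (LinearMap.shortExact_shortComplexKer hg) _ (Abelian.Ext.mk₀ (frobeniusTwistOfHom f))
    (add_zero 1) (h.elim _ _)
  obtain ⟨k, rfl⟩ := (Abelian.Ext.mk₀_bijective _ _).2 z
  rw [Abelian.Ext.mk₀_comp_mk₀] at hz
  have hz' := (Abelian.Ext.mk₀_bijective _ _).1 hz
  exact ⟨frobeniusTwistHom k, fun w => congrArg (fun k => k.hom w) hz'⟩

end Twist

/-! ### Vanishing of Hom and regular sequences in the annihilator -/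

section Vanishing
open Pointwise IsLocalRing RingTheory.Sequence
variable {R : Type u} [CommRing R] {p : ℕ} [Fact p.Prime] [CharP R p] {e : ℕ}
  {M : Type u} [AddCommGroup M] [Module R M] {W : Type u} [AddCommGroup W] [Module R W]

/-- Scalars act on semilinear maps through the untwisted structure of `M`. Modulo the first element
`x`, induction puts `f` in the remaining ideal times Hom; `Ext¹ = 0` lifts this to some `g`, and `f
- g`, with values in `xM`, is divisible by the regular element `x`. -/
theorem mem_ofList_smul_top_of_forall_apply_mem {xs : List R} (hreg : IsWeaklyRegular M xs)
    (hext : ∀ i, 1 ≤ i → i < xs.length →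
      Subsingleton (Abelian.Ext (ModuleCat.of R W) (frobeniusTwist R p e M) i))
    (f : W →ₛₗ[iterateFrobenius R p e] M)
    (hf : ∀ w, f w ∈ Ideal.ofList xs • (⊤ : Submodule R M)) :
    f ∈ Ideal.ofList xs • (⊤ : Submodule R (W →ₛₗ[iterateFrobenius R p e] M)) := by
  induction xs generalizing M with
  | nil =>
    have : f = 0 := LinearMap.ext fun w => by simpa using hf w
    rw [this]
    exact zero_mem _
  | cons x xs ih =>
    rw [isWeaklyRegular_cons_iff] at hreg
    obtain ⟨hx, hreg⟩ := hreg
    let q : M →ₗ[R] QuotSMulTop x M := Submodule.mkQ _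
    have hq : ∀ m ∈ Ideal.ofList (x :: xs) • (⊤ : Submodule R M),
        q m ∈ Ideal.ofList xs • (⊤ : Submodule R (QuotSMulTop x M)) := by
      intro m hm
      rw [Ideal.ofList_cons_smul, Submodule.mem_sup] at hm
      obtain ⟨a, ha, b, hb, rfl⟩ := hm
      have ha' : q a = 0 := (Submodule.Quotient.mk_eq_zero _).mpr ha
      rw [map_add, ha', zero_add]
      have := Submodule.mem_map_of_mem (f := q) hb
      rw [Submodule.map_smul''] at this
      exact Submodule.smul_mono le_rfl le_top this
    have hmem := ih hreg (fun i h1 h2 =>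
      subsingleton_ext_frobeniusTwist_quotSMulTop hx
        (hext i h1 (by simp only [List.length_cons]; omega))
        (hext (i + 1) (by omega) (by simp only [List.length_cons]; omega)))
      (q.comp f) (fun w => hq _ (hf w))
    obtain ⟨g, hg, hgf⟩ : ∃ g ∈ Ideal.ofList xs •
        (⊤ : Submodule R (W →ₛₗ[iterateFrobenius R p e] M)), q.comp g = q.comp f := by
      -- For a single element no `Ext¹` vanishing is available, but then `q.comp f = 0` and `g = 0`
      -- serves.
      rcases eq_or_ne xs [] with rfl | hne
      · refine ⟨0, zero_mem _, ?_⟩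
        rw [LinearMap.comp_zero]
        rw [Ideal.ofList_nil, Submodule.bot_smul, Submodule.mem_bot] at hmem
        exact hmem.symm
      · have h1 : 1 < (x :: xs).length := by
          have := List.length_pos_iff.mpr hne
          simp only [List.length_cons]; omega
        let Φ : (W →ₛₗ[iterateFrobenius R p e] M) →ₗ[R]
            (W →ₛₗ[iterateFrobenius R p e] QuotSMulTop x M) :=
          { toFun := fun g => q.comp g
            map_add' := fun a b => LinearMap.comp_add _ _ _
            map_smul' := fun r a => LinearMap.ext fun w => q.map_smul r (a w) }
        have hΦ : Function.Surjective Φ := fun k =>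
          exists_lift_frobeniusTwist_quotSMulTop hx (hext 1 le_rfl h1) k
        rw [← LinearMap.range_eq_top.mpr hΦ, LinearMap.range_eq_map, ← Submodule.map_smul''] at hmem
        obtain ⟨g, hg, h⟩ := hmem
        exact ⟨g, hg, h⟩
    have hdiv : ∀ w, ∃ m : M, x • m = f w - g w := by
      intro w
      have : f w - g w ∈ x • (⊤ : Submodule R M) := by
        rw [← Submodule.Quotient.mk_eq_zero]
        have h := congrArg (fun k => k w) hgf
        change q (f w - g w) = 0
        rw [map_sub, sub_eq_zero]
        exact h.symm
      obtain ⟨m, -, hm⟩ := Submodule.mem_smul_pointwise_iff_exists _ _ _ |>.mp this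
      exact ⟨m, hm⟩
    choose h hh using hdiv
    let k : W →ₛₗ[iterateFrobenius R p e] M :=
      { toFun := h
        map_add' := fun a b => hx <| by
          change x • h (a + b) = x • (h a + h b)
          rw [smul_add, hh, hh, hh, map_add, map_add]; abel
        map_smul' := fun r a => hx <| by
          change x • h (r • a) = x • (iterateFrobenius R p e r • h a)
          rw [smul_comm, hh, hh, map_smulₛₗ, map_smulₛₗ, smul_sub] }
    have hfk : f = x • k + g := LinearMap.ext fun w => by
      change f w = x • h w + g w
      rw [hh, sub_add_cancel]
    rw [hfk, Ideal.ofList_cons_smul]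
    exact add_mem (Submodule.mem_sup_left (Submodule.smul_mem_pointwise_smul _ _ _ trivial))
      (Submodule.mem_sup_right hg)

instance finite_iterateFrobenius_semilinearMap [IsNoetherianRing R] [Module.Finite R M]
    [Module.Finite R W] : Module.Finite R (W →ₛₗ[iterateFrobenius R p e] M) := by
  obtain ⟨n, s, hs⟩ := Module.Finite.exists_fin (R := R) (M := W)
  let Φ : (W →ₛₗ[iterateFrobenius R p e] M) →ₗ[R] (Fin n → M) :=
    { toFun := fun f i => f (s i)
      map_add' := fun a b => rfl
      map_smul' := fun r a => rfl }
  refine Module.Finite.of_injective Φ fun f g hfg => ?_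
  exact LinearMap.ext_on_range hs fun i => congrFun hfg i

theorem eq_zero_of_forall_apply_mem_ofList_smul_top [IsNoetherianRing R] [IsLocalRing R]
    [Module.Finite R M] [Module.Finite R W] {xs : List R} (hxs : ∀ r ∈ xs, r ∈ maximalIdeal R)
    (hreg : IsWeaklyRegular M xs)
    (hext : ∀ i, 1 ≤ i → i < xs.length →
      Subsingleton (Abelian.Ext (ModuleCat.of R W) (frobeniusTwist R p e M) i))
    (hf : ∀ (f : W →ₛₗ[iterateFrobenius R p e] M) (w : W),
      f w ∈ Ideal.ofList xs • (⊤ : Submodule R M))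
    (f : W →ₛₗ[iterateFrobenius R p e] M) : f = 0 := by
  have h : (⊤ : Submodule R (W →ₛₗ[iterateFrobenius R p e] M)) = ⊥ := by
    refine Submodule.eq_bot_of_le_smul_of_le_jacobson_bot (Ideal.ofList xs) ⊤
      Module.Finite.fg_top
      (fun f _ => mem_ofList_smul_top_of_forall_apply_mem hreg hext f (hf f)) ?_
    exact (Ideal.span_le.mpr hxs).trans (maximalIdeal_le_jacobson _)
  have : f ∈ (⊤ : Submodule R (W →ₛₗ[iterateFrobenius R p e] M)) := trivial
  rw [h] at this
  exact this

/-- Otherwise prime avoidance puts `ann W` inside an associated prime `P` of `M`. Then `Hom(W, R/P)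
≠ 0`, while `R/P` embeds in `ᵉM`, so a nonzero map `W → ᵉM` exists. -/
theorem exists_isSMulRegular_mem_annihilator [IsNoetherianRing R]
    [Module.Finite R M] [Module.Finite R W]
    (h : ∀ f : W →ₛₗ[iterateFrobenius R p e] M, f = 0) :
    ∃ y ∈ Module.annihilator R W, IsSMulRegular M y := by
  cases subsingleton_or_nontrivial M
  · exact ⟨0, zero_mem _, IsSMulRegular.zero⟩
  by_contra! hcon
  obtain ⟨P, hP, hle⟩ : ∃ P ∈ associatedPrimes R M, Module.annihilator R W ≤ P := by
    obtain ⟨I, hI⟩ := associatedPrimes.nonempty R M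
    apply (Ideal.subset_union_prime_finite (associatedPrimes.finite R M) I I _).mp
    · rw [biUnion_associatedPrimes_eq_compl_regular R M]
      exact fun r hr => hcon r hr
    · exact fun I hin _ _ => IsAssociatedPrime.isPrime hin
  have hprime : P.IsPrime := hP.isPrime
  obtain ⟨z, hz⟩ := (isAssociatedPrime_iff.mp hP).2
  have hz' : ∀ r : R, r ∈ P ↔ r • z = 0 := fun r => by
    rw [hz]; simp
  have hne : ¬ Subsingleton (W →ₗ[R] (R ⧸ P)) := by
    rw [IsSMulRegular.subsingleton_linearMap_iff]
    rintro ⟨r, hr, hreg⟩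
    have h1 : (1 : R ⧸ P) = 0 := hreg <| by
      change r • (1 : R ⧸ P) = r • (0 : R ⧸ P)
      rw [smul_zero, Algebra.smul_def, mul_one]
      exact Ideal.Quotient.eq_zero_iff_mem.mpr (hle hr)
    exact one_ne_zero h1
  apply hne
  refine subsingleton_of_forall_eq 0 fun k => LinearMap.ext fun w => ?_
  -- With `P = ann z`, the map `a ↦ a^(p^e) z` is injective on `R/P` because `P` is prime.
  obtain ⟨φ, hφ⟩ : ∃ φ : (R ⧸ P) →ₛₗ[iterateFrobenius R p e] M,
      ∀ a, φ a = 0 → a = 0 := by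
    let φ₀ : R →ₛₗ[iterateFrobenius R p e] M :=
      { toFun := fun a => iterateFrobenius R p e a • z
        map_add' := fun a b => by rw [map_add, add_smul]
        map_smul' := fun r a => by rw [smul_eq_mul, map_mul, mul_smul] }
    refine ⟨Submodule.liftQ P φ₀ fun a ha => ?_, fun a => ?_⟩
    · change iterateFrobenius R p e a • z = 0
      rw [← hz', iterateFrobenius_def]
      exact Ideal.pow_mem_of_mem _ ha _ (pow_pos (Fact.out : p.Prime).pos _)
    · obtain ⟨a, rfl⟩ := Submodule.mkQ_surjective P a
      intro ha
      change iterateFrobenius R p e a • z = 0 at ha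
      rw [← hz', iterateFrobenius_def] at ha
      exact (Submodule.Quotient.mk_eq_zero _).mpr (hprime.mem_of_pow_mem _ ha)
  exact hφ _ (congrArg (fun l => l w) (h (φ.comp k)))

/-- Rees's argument: each regular element `y` of `ann W` costs one degree of Ext vanishing on
passing to `M/yM`. -/
theorem exists_isWeaklyRegular_annihilator [IsNoetherianRing R]
    [Module.Finite R M] [Module.Finite R W] (n : ℕ)
    (hext : ∀ i < n, Subsingleton (Abelian.Ext (ModuleCat.of R W) (frobeniusTwist R p e M) i)) :
    ∃ ys : List R, ys.length = n ∧ (∀ y ∈ ys, y ∈ Module.annihilator R W) ∧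
      IsWeaklyRegular M ys := by
  induction n generalizing M with
  | zero => exact ⟨[], rfl, by simp, IsWeaklyRegular.nil R M⟩
  | succ n ih =>
    have h0 : ∀ f : W →ₛₗ[iterateFrobenius R p e] M, f = 0 := by
      intro f
      have := (Abelian.Ext.mk₀_bijective _ _).1 ((hext 0 (by omega)).elim
        (Abelian.Ext.mk₀ (frobeniusTwistOfHom f)) (Abelian.Ext.mk₀ 0))
      exact LinearMap.ext fun w => congrArg (fun k => k.hom w) this
    obtain ⟨y, hy, hreg⟩ := exists_isSMulRegular_mem_annihilator h0
    obtain ⟨ys, hlen, hys, hregs⟩ := ih (M := QuotSMulTop y M) fun i hi =>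
      subsingleton_ext_frobeniusTwist_quotSMulTop hreg (hext i (by omega))
        (hext (i + 1) (by omega))
    refine ⟨y :: ys, by simp [hlen], ?_, hregs.cons hreg⟩
    simpa using ⟨hy, hys⟩

end Vanishing

/-! ### The inequality `pd ≤ depth` of Auslander-Buchsbaum -/

section AuslanderBuchsbaum
open IsLocalRing RingTheory.Sequence

/-- A syzygy gains one unit of depth: reduction modulo an element regular on `V` keeps the sequence
short exact, and once `V` has no more to offer, the next element is still regular on `W ⊆ F`. -/
theorem isWeaklyRegular_take_succ_of_exact {R : Type*} [CommRing R] {W F V : Type*}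
    [AddCommGroup W] [Module R W] [AddCommGroup F] [Module R F] [AddCommGroup V] [Module R V]
    {f : W →ₗ[R] F} {g : F →ₗ[R] V} (hf : Function.Injective f) (hfg : Function.Exact f g)
    (hg : Function.Surjective g) {ys : List R} {k : ℕ} (hF : IsWeaklyRegular F ys)
    (hV : IsWeaklyRegular V (ys.take k)) : IsWeaklyRegular W (ys.take (k + 1)) := by
  induction ys generalizing W F V k with
  | nil => simp
  | cons y ys ih =>
    rw [isWeaklyRegular_cons_iff] at hF
    have hy : IsSMulRegular W y := hF.1.of_injective f hf
    cases k with
    | zero => simpa using hy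
    | succ k =>
      rw [List.take_succ_cons, isWeaklyRegular_cons_iff] at hV ⊢
      refine ⟨hy, ih ?_ (QuotSMulTop.map_exact y hfg hg) (QuotSMulTop.map_surjective y hg)
        hF.2 hV.2⟩
      have h0 : Function.Exact (0 : W →ₗ[R] W) f := (LinearMap.exact_zero_iff_injective W f).mpr hf
      have h1 := QuotSMulTop.map_first_exact_on_four_term_exact_of_isSMulRegular_last h0 hfg hV.1
      rw [map_zero] at h1
      exact (LinearMap.exact_zero_iff_injective _ _).mp h1

/-- Regularity on `V` keeps `W → F` injective modulo `ys`. -/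
theorem mem_ofList_smul_top_of_exact {R : Type*} [CommRing R] {W F V : Type*}
    [AddCommGroup W] [Module R W] [AddCommGroup F] [Module R F] [AddCommGroup V] [Module R V]
    {f : W →ₗ[R] F} {g : F →ₗ[R] V} (hf : Function.Injective f) (hfg : Function.Exact f g)
    (hg : Function.Surjective g) {ys : List R} (hV : IsWeaklyRegular V ys) {w : W}
    (hw : f w ∈ Ideal.ofList ys • (⊤ : Submodule R F)) :
    w ∈ Ideal.ofList ys • (⊤ : Submodule R W) := by
  have h0 : Function.Exact (0 : W →ₗ[R] W) f := (LinearMap.exact_zero_iff_injective W f).mpr hf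
  have h1 := map_first_exact_on_four_term_right_exact_of_isSMulRegular_last h0 hfg hg hV
  obtain ⟨v, hv⟩ := (h1 (Submodule.Quotient.mk w)).mp ((Submodule.Quotient.mk_eq_zero _).mpr hw)
  obtain ⟨v, rfl⟩ := Submodule.mkQ_surjective _ v
  rw [← Submodule.Quotient.mk_eq_zero, ← hv]
  rfl

theorem isWeaklyRegular_pi_fin {R : Type*} [CommRing R] {ys : List R} (h : IsWeaklyRegular R ys)
    (n : ℕ) : IsWeaklyRegular (Fin n → R) ys :=
  ((TensorProduct.rid R (Fin n → R)).isWeaklyRegular_congr ys).mp h.isWeaklyRegular_lTensor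

theorem pi_mem_ideal_smul_top {R : Type*} [CommRing R] {I : Ideal R} {n : ℕ} {x : Fin n → R}
    (hx : ∀ i, x i ∈ I) : x ∈ I • (⊤ : Submodule R (Fin n → R)) := by
  rw [pi_eq_sum_univ' x]
  exact Submodule.sum_mem _ fun i _ => Submodule.smul_mem_smul (hx i) trivial

variable {R : Type u} [CommRing R] [IsLocalRing R]

/-- If `𝔪` is associated to `R ⧸ (ys)`, a minimal first syzygy of a module on which `ys` is
weakly regular is not a nonzero free module. -/
theorem subsingleton_ker_of_isWeaklyRegular {V : Type u} [AddCommGroup V] [Module R V]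
    {n : ℕ} {g : (Fin n → R) →ₗ[R] V} (hg : Function.Surjective g)
    (hmin : ∀ x ∈ LinearMap.ker g, ∀ i, x i ∈ maximalIdeal R)
    [Module.Free R (LinearMap.ker g)] {ys : List R} (hV : IsWeaklyRegular V ys)
    {s : R} (hs : s ∉ Ideal.ofList ys) (hms : ∀ r ∈ maximalIdeal R, r * s ∈ Ideal.ofList ys) :
    Subsingleton (LinearMap.ker g) := by
  refine subsingleton_of_forall_eq 0 fun w => ?_
  let b := Module.Free.chooseBasis R (LinearMap.ker g)
  by_contra hw
  have hne : Nonempty (Module.Free.ChooseBasisIndex R (LinearMap.ker g)) := by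
    by_contra hempty
    rw [not_nonempty_iff] at hempty
    exact hw (b.repr.injective (Subsingleton.elim _ _))
  obtain ⟨j⟩ := hne
  -- The entries of `b j` lie in `𝔪`, which `s` multiplies into `(ys)`; reading the `j`-th
  -- coordinate will force `s ∈ (ys)`.
  have h1 : s • b j ∈ Ideal.ofList ys • (⊤ : Submodule R (LinearMap.ker g)) := by
    refine mem_ofList_smul_top_of_exact (Submodule.injective_subtype _)
      (LinearMap.exact_subtype_ker_map g) hg hV (pi_mem_ideal_smul_top fun i => ?_)
    have := hms _ (hmin _ (b j).2 i)
    rw [mul_comm] at this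
    exact this
  have h2 := Submodule.mem_map_of_mem (f := b.coord j) h1
  rw [Submodule.map_smul''] at h2
  have h3 := Submodule.smul_mono le_rfl le_top h2
  rw [smul_eq_mul, Ideal.mul_top] at h3
  simp at h3
  exact hs h3

variable [IsNoetherianRing R]

/-- After `n` syzygies all of `ys` is regular and the projective dimension is at most `1`. The next
minimal syzygy is then free, hence zero because `𝔪` is associated to `R/(ys)`. -/
theorem hasProjectiveDimensionLT_of_isWeaklyRegular {ys : List R} (hys : IsWeaklyRegular R ys)
    {s : R} (hs : s ∉ Ideal.ofList ys) (hms : ∀ r ∈ maximalIdeal R, r * s ∈ Ideal.ofList ys)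
    (n k : ℕ) (hlen : ys.length ≤ k + n) (V : Type u) [AddCommGroup V] [Module R V]
    [Module.Finite R V] (hV : IsWeaklyRegular V (ys.take k))
    (hpd : HasProjectiveDimensionLT (ModuleCat.of R V) (n + 2)) :
    HasProjectiveDimensionLT (ModuleCat.of R V) (n + 1) := by
  obtain ⟨m, g, hg, hmin⟩ := exists_pi_surjective_ker_le_maximalIdeal R V
  have hS := LinearMap.shortExact_shortComplexKer hg
  have hP : Projective (ModuleCat.of R (Fin m → R)) :=
    (IsProjective.iff_projective _).mp inferInstance
  have hW : HasProjectiveDimensionLT (ModuleCat.of R (LinearMap.ker g)) (n + 1) :=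
    (hS.hasProjectiveDimensionLT_X₃_iff n hP).mp hpd
  induction n generalizing k V m with
  | zero =>
    rw [List.take_of_length_le (by omega)] at hV
    have hWP : Module.Projective R (LinearMap.ker g) := (IsProjective.iff_projective _).mpr
      (projective_iff_hasProjectiveDimensionLT_one.mpr hW)
    have hfree : Module.Free R (LinearMap.ker g) := Module.free_of_flat_of_isLocalRing
    have hsub := subsingleton_ker_of_isWeaklyRegular hg hmin hV hs hms
    have hz : HasProjectiveDimensionLT (ModuleCat.of R (LinearMap.ker g)) 0 :=
      (ModuleCat.isZero_of_subsingleton _).hasProjectiveDimensionLT_zero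
    exact hS.hasProjectiveDimensionLT_X₃ 0 hz
      (projective_iff_hasProjectiveDimensionLT_one.mp hP)
  | succ n ih =>
    have hWreg := isWeaklyRegular_take_succ_of_exact (Submodule.injective_subtype _)
      (LinearMap.exact_subtype_ker_map g) hg (isWeaklyRegular_pi_fin hys m) hV
    obtain ⟨m', g', hg', hmin'⟩ := exists_pi_surjective_ker_le_maximalIdeal R (LinearMap.ker g)
    have hP' : Projective (ModuleCat.of R (Fin m' → R)) :=
      (IsProjective.iff_projective _).mp inferInstance
    have h := ih (k + 1) (by omega) _ hWreg hW m' g' hg' hmin'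
      (LinearMap.shortExact_shortComplexKer hg') hP'
      (((LinearMap.shortExact_shortComplexKer hg').hasProjectiveDimensionLT_X₃_iff n hP').mp hW)
    exact (hS.hasProjectiveDimensionLT_X₃_iff n hP).mpr h

/-- If a regular sequence of length `j < n` cannot be extended, `𝔪` is associated to `R/(ys)`, and
the projective dimension would drop below `n`. -/
theorem exists_isRegular_length_eq_of_hasProjectiveDimensionLT {V : Type u} [AddCommGroup V]
    [Module R V] [Module.Finite R V] {n : ℕ}
    (hpd : HasProjectiveDimensionLT (ModuleCat.of R V) (n + 1))
    (hnot : ¬ HasProjectiveDimensionLT (ModuleCat.of R V) n) (j : ℕ) (hj : j ≤ n) :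
    ∃ ys : List R, (∀ r ∈ ys, r ∈ maximalIdeal R) ∧ IsRegular R ys ∧ ys.length = j := by
  induction j with
  | zero => exact ⟨[], by simp, IsRegular.nil R R, rfl⟩
  | succ j ih =>
    obtain ⟨ys, hmem, hreg, hlen⟩ := ih (by omega)
    by_cases hex : ∃ r ∈ maximalIdeal R,
        IsSMulRegular (R ⧸ Ideal.ofList ys • (⊤ : Submodule R R)) r
    · obtain ⟨r, hr, hrreg⟩ := hex
      have hmem' : ∀ r' ∈ ys ++ [r], r' ∈ maximalIdeal R := by
        intro r' hr'
        rw [List.mem_append, List.mem_singleton] at hr'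
        rcases hr' with h | rfl
        · exact hmem _ h
        · exact hr
      refine ⟨ys ++ [r], hmem', IsRegular.of_isWeaklyRegular_of_mem_maximalIdeal R hmem' ?_,
        by simp [hlen]⟩
      rw [isWeaklyRegular_append_iff, isWeaklyRegular_singleton_iff]
      exact ⟨hreg.toIsWeaklyRegular, hrreg⟩
    · exfalso
      have hne : ¬ Subsingleton ((R ⧸ maximalIdeal R) →ₗ[R]
          (R ⧸ Ideal.ofList ys • (⊤ : Submodule R R))) := by
        rw [IsSMulRegular.subsingleton_linearMap_iff, Ideal.annihilator_quotient]
        exact hex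
      -- The socle element `s` is a lift of `φ 1` for a nonzero `φ : R/𝔪 → R/(ys)`.
      obtain ⟨φ, hφ⟩ := not_forall.mp (mt (subsingleton_of_forall_eq 0) hne)
      obtain ⟨s, hs⟩ := Submodule.mkQ_surjective _ (φ 1)
      have hI : Ideal.ofList ys • (⊤ : Submodule R R) = Ideal.ofList ys := by
        rw [smul_eq_mul, Ideal.mul_top]
      have hs1 : s ∉ Ideal.ofList ys := by
        intro hmem
        apply hφ
        have h1 : φ 1 = 0 := by
          rw [← hs]
          exact (Submodule.Quotient.mk_eq_zero _).mpr (hI.symm ▸ hmem)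
        refine LinearMap.ext fun x => ?_
        obtain ⟨x, rfl⟩ := Submodule.mkQ_surjective _ x
        have : (Submodule.mkQ (maximalIdeal R)) x = x • (1 : R ⧸ maximalIdeal R) := by
          rw [Algebra.smul_def, mul_one]; rfl
        rw [this, map_smul, h1, smul_zero, LinearMap.zero_apply]
      have hs2 : ∀ r ∈ maximalIdeal R, r * s ∈ Ideal.ofList ys := by
        intro r hr
        rw [← hI, ← smul_eq_mul, ← Submodule.Quotient.mk_eq_zero]
        have : r • (1 : R ⧸ maximalIdeal R) = 0 := by
          rw [Algebra.smul_def, mul_one]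
          exact Ideal.Quotient.eq_zero_iff_mem.mpr hr
        change Submodule.mkQ _ (r • s) = 0
        rw [map_smul, hs, ← map_smul, this, map_zero]
      obtain ⟨n, rfl⟩ : ∃ n', n = n' + 1 := ⟨n - 1, by omega⟩
      exact hnot (hasProjectiveDimensionLT_of_isWeaklyRegular hreg.toIsWeaklyRegular hs1 hs2 n 0
        (by omega) V (by simp) hpd)

/-- The inequality `pd V ≤ depth R` of the Auslander-Buchsbaum formula. -/
theorem projectiveDimension_le_moduleDepth {V : Type u} [AddCommGroup V] [Module R V]
    [Module.Finite R V] {n : ℕ} (hpd : HasProjectiveDimensionLT (ModuleCat.of R V) n) :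
    projectiveDimension (ModuleCat.of R V) ≤ (moduleDepth R R : WithBot ℕ∞) := by
  induction n with
  | zero =>
    have := (projectiveDimension_eq_bot_iff (ModuleCat.of R V)).mpr
      ((hasProjectiveDimensionLT_zero_iff_isZero _).mp hpd)
    rw [this]
    exact bot_le
  | succ n ih =>
    by_cases hn : HasProjectiveDimensionLT (ModuleCat.of R V) n
    · exact ih hn
    · obtain ⟨ys, hmem, hreg, hlen⟩ :=
        exists_isRegular_length_eq_of_hasProjectiveDimensionLT hpd hn n le_rfl
      have h1 := (projectiveDimension_le_iff (ModuleCat.of R V) n).mpr hpd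
      have h2 := length_le_moduleDepth hmem hreg
      rw [hlen] at h2
      exact h1.trans (by exact_mod_cast h2)

end AuslanderBuchsbaum

/-! ### Ext vanishing forces finite projective dimension -/

section Rigidity
open IsLocalRing RingTheory.Sequence

theorem exists_isSMulRegular_of_one_le_moduleDepth {R : Type*} [CommRing R] [IsLocalRing R]
    (h : 1 ≤ moduleDepth R R) : ∃ r ∈ maximalIdeal R, IsSMulRegular R r := by
  obtain ⟨xs, hxs, hreg, hlen⟩ := exists_isRegular_length_eq_of_le_moduleDepth (n := 1) le_rfl
    (by exact_mod_cast h)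
  match xs with
  | [] => simp at hlen
  | x :: xs => exact ⟨x, hxs x (by simp), ((isRegular_cons_iff R x xs).mp hreg).1⟩

variable {R : Type u} [CommRing R] [IsLocalRing R] {p : ℕ} [Fact p.Prime] [CharP R p] {e : ℕ}
  {M : Type u} [AddCommGroup M] [Module R M]

/-- Semilinearity turns coordinates in `𝔪` into their `p^e`-th powers. -/
theorem apply_mem_maximalIdeal_pow_smul_top {n : ℕ}
    (k : (Fin n → R) →ₛₗ[iterateFrobenius R p e] M) {x : Fin n → R}
    (hx : ∀ i, x i ∈ maximalIdeal R) :
    k x ∈ maximalIdeal R ^ p ^ e • (⊤ : Submodule R M) := by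
  have h : k x = ∑ i, x i ^ p ^ e • k (Pi.single i 1) := by
    conv_lhs => rw [pi_eq_sum_univ' x, map_sum]
    refine Finset.sum_congr rfl fun i _ => ?_
    rw [map_smulₛₗ, iterateFrobenius_def]
  rw [h]
  exact Submodule.sum_mem _ fun i _ =>
    Submodule.smul_mem_smul (Ideal.pow_mem_pow (hx i) _) trivial

variable [IsNoetherianRing R] [Module.Finite R M]

/-- The heart of the case `t = 1`: the minimal first syzygy is killed by a power of `r`, yet sits in
a free module on which `r` is regular. -/
theorem subsingleton_ker_of_subsingleton_ext {r : R} (hr : r ∈ maximalIdeal R)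
    (hrreg : IsSMulRegular R r) (hsupp : Module.support R M = Set.univ) {xs : List R}
    (hxs : ∀ r ∈ xs, r ∈ maximalIdeal R) (hreg : IsRegular M xs)
    (hdim : Module.supportDim R M = xs.length)
    (he : maximalIdeal R ^ p ^ e ≤ Ideal.ofList xs)
    {N : Type u} [AddCommGroup N] [Module R N] {n : ℕ} {g : (Fin n → R) →ₗ[R] N}
    (hg : Function.Surjective g) (hmin : ∀ x ∈ LinearMap.ker g, ∀ i, x i ∈ maximalIdeal R)
    (hpos : 1 ≤ xs.length)
    (hext : ∀ i, 1 ≤ i → i ≤ xs.length →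
      Subsingleton (Abelian.Ext (ModuleCat.of R N) (frobeniusTwist R p e M) i)) :
    Subsingleton (LinearMap.ker g) := by
  have hextW : ∀ i, 1 ≤ i → i < xs.length → Subsingleton
      (Abelian.Ext (ModuleCat.of R (LinearMap.ker g)) (frobeniusTwist R p e M) i) := by
    intro i h1 h2
    obtain ⟨i, rfl⟩ : ∃ i', i = i' + 1 := ⟨i - 1, by omega⟩
    exact subsingleton_ext_ker hg _ (hext (i + 2) (by omega) (by omega))
  -- Minimality of `g` and the choice of `e` enter here.
  have hzero : ∀ f : LinearMap.ker g →ₛₗ[iterateFrobenius R p e] M, f = 0 := by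
    refine eq_zero_of_forall_apply_mem_ofList_smul_top hxs hreg.toIsWeaklyRegular hextW
      fun f w => ?_
    obtain ⟨k, hk⟩ := exists_extend_ker_frobeniusTwist hg (hext 1 le_rfl hpos) f
    rw [← hk]
    exact Submodule.smul_mono_left he (apply_mem_maximalIdeal_pow_smul_top k (hmin w w.2))
  have hext0 : Subsingleton
      (Abelian.Ext (ModuleCat.of R (LinearMap.ker g)) (frobeniusTwist R p e M) 0) := by
    refine subsingleton_of_forall_eq 0 fun z => ?_
    obtain ⟨f, rfl⟩ := (Abelian.Ext.mk₀_bijective _ _).2 z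
    have : f = 0 := ModuleCat.hom_ext (LinearMap.ext fun w =>
      congrArg (fun k => k w) (hzero (frobeniusTwistHom f)))
    rw [this, Abelian.Ext.mk₀_zero]
  by_contra hnot
  rw [not_subsingleton_iff_nontrivial] at hnot
  obtain ⟨ys, hlen, hann, hys⟩ := exists_isWeaklyRegular_annihilator (M := M)
    (W := LinearMap.ker g) (p := p) (e := e) xs.length fun i hi => by
      rcases Nat.eq_zero_or_pos i with rfl | h
      · exact hext0
      · exact hextW i h hi
  have hmem : ∀ y ∈ ys, y ∈ maximalIdeal R := fun y hy =>
    le_maximalIdeal (fun h => by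
      rw [Module.annihilator_eq_top_iff] at h
      exact not_subsingleton _ h) (hann y hy)
  have hMnt : Nontrivial M := hreg.nontrivial
  obtain ⟨m, hm⟩ := exists_maximalIdeal_pow_le_ofList hsupp
    (IsRegular.of_isWeaklyRegular_of_mem_maximalIdeal M hmem hys) (by rw [hdim, hlen])
  have hrm : r ^ m ∈ Module.annihilator R (LinearMap.ker g) :=
    (hm.trans (Ideal.span_le.mpr hann)) (Ideal.pow_mem_pow hr m)
  obtain ⟨w, hw⟩ := exists_ne (0 : LinearMap.ker g)
  apply hw
  have hw0 := Module.mem_annihilator.mp hrm w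
  refine Subtype.ext (funext fun i => hrreg.pow m ?_)
  have := congrFun (congrArg Subtype.val hw0) i
  simpa using this

/-- Dimension shifting in `t`, which is one less than the `t` of the main theorem. -/
theorem hasProjectiveDimensionLT_of_subsingleton_ext {r : R} (hr : r ∈ maximalIdeal R)
    (hrreg : IsSMulRegular R r) (hsupp : Module.support R M = Set.univ) {xs : List R}
    (hxs : ∀ r ∈ xs, r ∈ maximalIdeal R) (hreg : IsRegular M xs)
    (hdim : Module.supportDim R M = xs.length)
    (he : maximalIdeal R ^ p ^ e ≤ Ideal.ofList xs) (hpos : 1 ≤ xs.length) (t : ℕ)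
    (N : Type u) [AddCommGroup N] [Module R N] [Module.Finite R N]
    (hext : ∀ i, t + 1 ≤ i → i ≤ t + xs.length →
      Subsingleton (Abelian.Ext (ModuleCat.of R N) (frobeniusTwist R p e M) i)) :
    HasProjectiveDimensionLT (ModuleCat.of R N) (t + 1) := by
  induction t generalizing N with
  | zero =>
    obtain ⟨n, g, hg, hmin⟩ := exists_pi_surjective_ker_le_maximalIdeal R N
    have hsub := subsingleton_ker_of_subsingleton_ext hr hrreg hsupp hxs hreg hdim he hg hmin hpos
      fun i h1 h2 => hext i (by omega) (by omega)
    have hP : Projective (ModuleCat.of R (Fin n → R)) :=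
      (IsProjective.iff_projective _).mp inferInstance
    have hz : HasProjectiveDimensionLT (ModuleCat.of R (LinearMap.ker g)) 0 :=
      (ModuleCat.isZero_of_subsingleton _).hasProjectiveDimensionLT_zero
    exact (LinearMap.shortExact_shortComplexKer hg).hasProjectiveDimensionLT_X₃ 0 hz
      (projective_iff_hasProjectiveDimensionLT_one.mp hP)
  | succ t ih =>
    obtain ⟨n, g, hg, -⟩ := exists_pi_surjective_ker_le_maximalIdeal R N
    have hP : Projective (ModuleCat.of R (Fin n → R)) :=
      (IsProjective.iff_projective _).mp inferInstance
    refine ((LinearMap.shortExact_shortComplexKer hg).hasProjectiveDimensionLT_X₃_iff t hP).mpr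
      (ih (LinearMap.ker g) fun i h1 h2 => ?_)
    obtain ⟨i, rfl⟩ : ∃ i', i = i' + 1 := ⟨i - 1, by omega⟩
    exact subsingleton_ext_ker hg _ (hext (i + 2) (by omega) (by omega))

end Rigidity

theorem mainTheorem2 {R : Type u} [CommRing R] [IsNoetherianRing R] [IsLocalRing R]
    (p : ℕ) [Fact p.Prime] [CharP R p]
    (d : ℕ) (hd : ringKrullDim R = d)
    (hdepth : 1 ≤ moduleDepth R R)
    {M : Type u} [AddCommGroup M] [Module R M]
    (hM : IsCohenMacaulayModule R M) (hsupp : Module.support R M = Set.univ) :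
    ∃ e₀ : ℕ, ∀ e : ℕ, e₀ ≤ e → ∀ t : ℕ, 1 ≤ t →
      ∀ (N : Type u) [AddCommGroup N] [Module R N] [Module.Finite R N],
        (∀ i : ℕ, t ≤ i → i ≤ t + d - 1 →
          Subsingleton (Abelian.Ext (ModuleCat.of R N) (frobeniusTwist R p e M) i)) →
        projectiveDimension (ModuleCat.of R N) ≤
          min ((t - 1 : ℕ) : WithBot ℕ∞) (moduleDepth R R : WithBot ℕ∞) := by
  have hfin : Module.Finite R M := hM.1
  have hdim : Module.supportDim R M = d := by
    rw [← hd, Module.supportDim, hsupp]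
    exact Order.krullDim_eq_of_orderIso OrderIso.Set.univ
  obtain ⟨r, hr, hrreg⟩ := exists_isSMulRegular_of_one_le_moduleDepth hdepth
  obtain ⟨xs, hxs, hreg, rfl⟩ := exists_isRegular_length_eq_supportDim hM hdim
  obtain ⟨n, hn⟩ := exists_maximalIdeal_pow_le_ofList hsupp hreg hdim
  -- Dimension `0` is excluded: `𝔪` would be nilpotent, contradicting the regular element `r ∈ 𝔪`.
  have hpos : 1 ≤ xs.length := by
    by_contra hlt
    have hnil : xs = [] := List.length_eq_zero_iff.mp (by omega)
    subst hnil
    have h0 : r ^ n = 0 := by simpa using hn (Ideal.pow_mem_pow hr n)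
    have h1 : (1 : R) = 0 := hrreg.pow n (by simp [h0])
    exact one_ne_zero h1
  refine ⟨n, fun e he t ht N _ _ _ hext => ?_⟩
  obtain ⟨t, rfl⟩ : ∃ t', t = t' + 1 := ⟨t - 1, by omega⟩
  -- Since `e < p^e`, the exponent `n` with `𝔪^n ⊆ (xs)` itself serves as `e₀`.
  have hpe : n ≤ p ^ e := he.trans (Nat.lt_pow_self (Fact.out : p.Prime).one_lt).le
  have hpd := hasProjectiveDimensionLT_of_subsingleton_ext (p := p) (e := e) hr hrreg hsupp hxs
    hreg hdim ((Ideal.pow_le_pow_right hpe).trans hn) hpos t N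
    fun i h1 h2 => hext i h1 (by omega)
  refine le_min ?_ (projectiveDimension_le_moduleDepth hpd)
  rw [Nat.add_sub_cancel]
  exact (projectiveDimension_le_iff _ t).mpr hpd
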